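/- For a prime power $q$ let $\mathbb{F}_q$ be the field with $q$ elements, and for subspaces $U,W\le\mathbb{F}_q^n$ let $d_S(U,W)=\dim U+\dim W-2\dim(U\cap W)$ be their subspace distance. Let $A_q(n,d;k)$ be the maximum cardinality of a set $\mathcal{C}$ of $k$-dimensional subspaces of $\mathbb{F}_q^n$ such that $d_S(U,W)\ge d$ for all $U,W\in\mathcal{C}$ with $U\ne W$. Then $A_2(13,4;5)\ge 4\,796\,825\,069$, and for every prime power $q$ $$A_q(13,4;5)\ge q^{32}+q^{28}+q^{26}+8q^{24}+q^{23}+3q^{22}+q^{21}+4q^{20}+4q^{19}+5q^{18}+q^{17}+9q^{16}+8q^{15}+9q^{14}+6q^{13}+7q^{12}+5q^{11}+q^{10}+5q^{9}+3q^{8}+q^{7}+3q^{6}+4q^{5}+3q^{4}+q^{3}+3q^{2}.$$ -/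

import Mathlib

namespace SubspaceCode

/-- The set `𝒢_q(n, k)` of all `k`-dimensional subspaces of `F ^ n`, where `F` is the field with
`q` elements. -/
def grassmannian (F : Type*) [Field F] (n k : ℕ) : Set (Submodule F (Fin n → F)) :=
  {U | Module.finrank F U = k}

/-- The subspace distance `dim U + dim W - 2 dim (U ∩ W)`. The subtraction is never truncated, see
`subspaceDist_add`. -/
noncomputable def subspaceDist {F : Type*} [Field F] {n : ℕ}
    (U W : Submodule F (Fin n → F)) : ℕ :=
  Module.finrank F U + Module.finrank F W - 2 * Module.finrank F (U ⊓ W : Submodule F (Fin n → F))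

theorem subspaceDist_add {F : Type*} [Field F] {n : ℕ} (U W : Submodule F (Fin n → F)) :
    subspaceDist U W + 2 * Module.finrank F (U ⊓ W : Submodule F (Fin n → F)) =
      Module.finrank F U + Module.finrank F W := by
  have h1 : Module.finrank F (U ⊓ W : Submodule F (Fin n → F)) ≤ Module.finrank F U :=
    Submodule.finrank_mono inf_le_left
  have h2 : Module.finrank F (U ⊓ W : Submodule F (Fin n → F)) ≤ Module.finrank F W :=
    Submodule.finrank_mono inf_le_right
  unfold subspaceDist
  omega

/-- `C` is an `(n, M, d, k)_q` constant dimension code over `F`: a set of `M` subspaces of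
dimension `k` of `F ^ n` any two different members of which have subspace distance at least `d`. -/
structure IsCDC (F : Type*) [Field F] (n M d k : ℕ) (C : Finset (Submodule F (Fin n → F))) :
    Prop where
  subset : ∀ U ∈ C, U ∈ grassmannian F n k
  card_eq : C.card = M
  le_dist : ∀ U ∈ C, ∀ W ∈ C, U ≠ W → d ≤ subspaceDist U W

/-- `A_q(n, d; k)`: the maximum cardinality `M` of an `(n, M, d, k)_q` constant dimension code over
the field `F` with `q` elements. -/
noncomputable def maxCDC (F : Type*) [Field F] (n d k : ℕ) : ℕ :=
  sSup {M | ∃ C : Finset (Submodule F (Fin n → F)), IsCDC F n M d k C}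

/-- Over a finite field the supremum in `maxCDC` is a maximum. -/
theorem isGreatest_maxCDC (F : Type*) [Field F] [Finite F] (n d k : ℕ) :
    IsGreatest {M | ∃ C : Finset (Submodule F (Fin n → F)), IsCDC F n M d k C}
      (maxCDC F n d k) := by
  have : Finite (Submodule F (Fin n → F)) :=
    Finite.of_injective (fun U : Submodule F (Fin n → F) => (U : Set (Fin n → F)))
      SetLike.coe_injective
  have hb : BddAbove {M | ∃ C : Finset (Submodule F (Fin n → F)), IsCDC F n M d k C} := by
    refine ⟨Nat.card (Submodule F (Fin n → F)), ?_⟩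
    rintro M ⟨C, hC⟩
    have := Fintype.ofFinite (Submodule F (Fin n → F))
    rw [← hC.card_eq, Nat.card_eq_fintype_card]
    exact Finset.card_le_univ C
  have hne : {M | ∃ C : Finset (Submodule F (Fin n → F)), IsCDC F n M d k C}.Nonempty :=
    ⟨0, ∅, by simp, by simp, by simp⟩
  exact ⟨Nat.sSup_mem hne hb, fun M hM => le_csSup hb hM⟩

end SubspaceCode

/-! Multilevel construction. A k-space has a reduced echelon form, with pivot set S and free entries
in a Ferrers shape. The leading position of a vector is a pivot, so two spaces with pivots S and T
meet in dimension at most |S ∩ T| (`finrank_inf_le_card_inter`). With equal pivots, meeting in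
dimension at least k - 1 forces the matrices to differ by rank at most one
(`exists_rank_one_of_finrank_inf`). It thus suffices to choose k-sets pairwise meeting in at most k
- 2 points and, for each, a linear code of matrices on its Ferrers shape without rank-one elements
(`exists_rank_two_code`). Such a code is the kernel of N ↦ ∑ N i j • (a i * b j) into an extension
field: a rank-one N maps to a product of two nonzero elements. Two explicit skeletons in `Fin 13`
then give the bounds; the polynomial at q = 2 is below the binary bound, hence the separate binary
skeleton. -/

namespace SubspaceCode

open Module

/-! ### Rank-metric codes with prescribed support -/

/-- A finite field has a field extension of every positive degree. -/
theorem exists_extension (F : Type*) [Field F] [Finite F] (m : ℕ) (hm : m ≠ 0) :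
    ∃ (K : Type) (_ : Field K) (_ : Algebra F K), Module.Finite F K ∧ finrank F K = m := by
  obtain ⟨p, hp⟩ := CharP.exists F
  have : Fact p.Prime := ⟨CharP.char_is_prime F p⟩
  have : NeZero m := ⟨hm⟩
  exact ⟨FiniteField.Extension F p m, inferInstance, inferInstance, inferInstance,
    FiniteField.finrank_extension F p m⟩

/-- A family indexed by `ι` whose restriction to the finite set `R` is linearly independent. -/
theorem exists_independent_on {F V ι : Type*} [Field F] [AddCommGroup V] [Module F V]
    [Module.Finite F V] (R : Finset ι) (hR : R.card ≤ finrank F V) :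
    ∃ a : ι → V, ∀ u : ι → F, (∑ i ∈ R, u i • a i = 0) → ∀ i ∈ R, u i = 0 := by
  classical
  obtain ⟨e⟩ : Nonempty (R ↪ Fin (finrank F V)) :=
    Function.Embedding.nonempty_of_card_le (by simpa using hR)
  have hli : LinearIndependent F (fun i : R => finBasis F V (e i)) :=
    (finBasis F V).linearIndependent.comp e e.injective
  refine ⟨fun i => if h : i ∈ R then finBasis F V (e ⟨i, h⟩) else 0, fun u hu i hi => ?_⟩
  rw [← Finset.sum_coe_sort] at hu
  exact Fintype.linearIndependent_iff.1 hli (fun i => u i) (by simpa using hu) ⟨i, hi⟩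

/-- Extension by zero of a matrix given by its entries on `D`. -/
def extendByZero (F : Type*) [Field F] {ι κ : Type*} [DecidableEq ι] [DecidableEq κ]
    (D : Finset (ι × κ)) : (D → F) →ₗ[F] (ι → κ → F) where
  toFun N i j := if h : (i, j) ∈ D then N ⟨(i, j), h⟩ else 0
  map_add' N N' := by ext i j; by_cases h : (i, j) ∈ D <;> simp [h]
  map_smul' c N := by ext i j; by_cases h : (i, j) ∈ D <;> simp [h]

theorem extendByZero_apply_mem {F : Type*} [Field F] {ι κ : Type*} [DecidableEq ι]
    [DecidableEq κ] {D : Finset (ι × κ)} (N : D → F) (p : D) :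
    extendByZero F D N p.1.1 p.1.2 = N p := by
  simp [extendByZero]

theorem extendByZero_apply_notMem {F : Type*} [Field F] {ι κ : Type*} [DecidableEq ι]
    [DecidableEq κ] {D : Finset (ι × κ)} (N : D → F) {i : ι} {j : κ} (h : (i, j) ∉ D) :
    extendByZero F D N i j = 0 := by
  simp [extendByZero, h]

theorem extendByZero_injective {F : Type*} [Field F] {ι κ : Type*} [DecidableEq ι]
    [DecidableEq κ] (D : Finset (ι × κ)) : Function.Injective (extendByZero F D) := by
  intro N N' h
  ext p
  rw [← extendByZero_apply_mem N p, h, extendByZero_apply_mem]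

/-- For every set `D` of positions there is a linear code of matrices supported on `D` without
matrices of rank one, of codimension at most the number of rows or columns meeting `D`. -/
theorem exists_rank_two_code (F : Type*) [Field F] [Finite F] {ι κ : Type*} [Fintype ι]
    [Fintype κ] [DecidableEq ι] [DecidableEq κ] (D : Finset (ι × κ)) :
    ∃ C : Submodule F (ι → κ → F),
      (∀ M ∈ C, ∀ i j, (i, j) ∉ D → M i j = 0) ∧
      (∀ M ∈ C, ∀ (u : ι → F) (v : κ → F), (∀ i j, M i j = u i * v j) → M = 0) ∧
      D.card - max (D.image Prod.fst).card (D.image Prod.snd).card ≤ finrank F C := by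
  rcases D.eq_empty_or_nonempty with rfl | hD
  -- For empty D the extension degree below would be zero.
  · exact ⟨⊥, by simp +contextual, by simp +contextual, by simp⟩
  set R := D.image Prod.fst with hR
  set T := D.image Prod.snd with hT
  have hm : max R.card T.card ≠ 0 := by
    have : 0 < R.card := Finset.card_pos.2 (hD.image _)
    omega
  -- This degree leaves room for both the row family and the column family to be independent.
  obtain ⟨K, _, _, _, hK⟩ := exists_extension F _ hm
  obtain ⟨a, ha⟩ := exists_independent_on (F := F) (V := K) R (by omega)
  obtain ⟨b, hb⟩ := exists_independent_on (F := F) (V := K) T (by omega)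
  let f : (D → F) →ₗ[F] K := Fintype.linearCombination F (fun p : D => a p.1.1 * b p.1.2)
  refine ⟨(LinearMap.ker f).map (extendByZero F D), ?_, ?_, ?_⟩
  · rintro _ ⟨N, -, rfl⟩ i j h
    exact extendByZero_apply_notMem N h
  · rintro _ ⟨N, hN, rfl⟩ u v huv
    by_contra hne
    obtain ⟨i₀, hi₀⟩ := Function.ne_iff.1 hne
    obtain ⟨j₀, hj₀⟩ := Function.ne_iff.1 hi₀
    have hij : u i₀ * v j₀ ≠ 0 := by rw [← huv]; exact hj₀
    have hmem : (i₀, j₀) ∈ D := by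
      by_contra h
      exact hj₀ (extendByZero_apply_notMem N h)
    have hoff : ∀ p ∈ R ×ˢ T, p ∉ D → (u p.1 * v p.2) • (a p.1 * b p.2) = 0 := by
      intro p _ hp
      rw [← huv, extendByZero_apply_notMem N hp, zero_smul]
    have hsub : D ⊆ R ×ˢ T := fun p hp =>
      Finset.mem_product.2 ⟨Finset.mem_image_of_mem _ hp, Finset.mem_image_of_mem _ hp⟩
    -- The product expands over R × T; positions outside D contribute nothing, and the rest is f N =
    -- 0.
    have hprod : (∑ i ∈ R, u i • a i) * (∑ j ∈ T, v j • b j) = 0 := by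
      rw [Finset.sum_mul_sum, ← Finset.sum_product']
      have h1 : ∑ p ∈ R ×ˢ T, u p.1 • a p.1 * v p.2 • b p.2 =
          ∑ p ∈ R ×ˢ T, (u p.1 * v p.2) • (a p.1 * b p.2) :=
        Finset.sum_congr rfl fun p _ => by rw [smul_mul_smul_comm]
      rw [h1, ← Finset.sum_subset hsub hoff, ← Finset.sum_coe_sort]
      have h2 : f N = 0 := hN
      rw [← h2, Fintype.linearCombination_apply]
      refine Finset.sum_congr rfl fun p _ => ?_
      rw [← huv, extendByZero_apply_mem]
    rcases mul_eq_zero.1 hprod with h | h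
    · exact hij (by rw [ha u h i₀ (Finset.mem_image_of_mem Prod.fst hmem), zero_mul])
    · exact hij (by rw [hb v h j₀ (Finset.mem_image_of_mem Prod.snd hmem), mul_zero])
  · rw [← (Submodule.equivMapOfInjective _ (extendByZero_injective D) _).finrank_eq]
    have h1 := f.finrank_range_add_finrank_ker
    have h2 : finrank F (LinearMap.range f) ≤ finrank F K := Submodule.finrank_le _
    rw [finrank_fintype_fun_eq_card, Fintype.card_coe] at h1
    omega

/-! ### Spaces in echelon form and their intersections -/

/-- The subspace with pivot set `S` whose nonpivot coordinates are given by the matrix `M`. -/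
def graphSpace {F : Type*} [Field F] {n : ℕ} (S : Finset (Fin n)) (M : Fin n → Fin n → F) :
    Submodule F (Fin n → F) where
  carrier := {x | ∀ j ∉ S, x j = ∑ i ∈ S, x i * M i j}
  zero_mem' := by simp
  add_mem' := by
    intro x y hx hy j hj
    simp [hx j hj, hy j hj, add_mul, Finset.sum_add_distrib]
  smul_mem' := by
    intro c x hx j hj
    simp [hx j hj, Finset.mul_sum, mul_assoc]

theorem mem_graphSpace {F : Type*} [Field F] {n : ℕ} {S : Finset (Fin n)}
    {M : Fin n → Fin n → F} {x : Fin n → F} :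
    x ∈ graphSpace S M ↔ ∀ j ∉ S, x j = ∑ i ∈ S, x i * M i j := Iff.rfl

/-- The positions in the rows of `S` that may be nonzero in an echelon form with pivots `S`. -/
def ferrers {n : ℕ} (S : Finset (Fin n)) : Finset (Fin n × Fin n) :=
  Finset.univ.filter fun p => p.1 ∈ S ∧ p.2 ∉ S ∧ p.1 < p.2

/-- Restriction of coordinates. -/
def restrictTo (F : Type*) [Field F] {n : ℕ} (S : Finset (Fin n)) : (Fin n → F) →ₗ[F] (S → F) :=
  LinearMap.funLeft F F Subtype.val

theorem eq_zero_of_restrictTo_eq_zero {F : Type*} [Field F] {n : ℕ} {S : Finset (Fin n)}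
    {M : Fin n → Fin n → F} {x : Fin n → F} (hx : x ∈ graphSpace S M)
    (h0 : restrictTo F S x = 0) : x = 0 := by
  have hS : ∀ i ∈ S, x i = 0 := fun i hi => congrFun h0 ⟨i, hi⟩
  ext j
  by_cases hj : j ∈ S
  · exact hS j hj
  · rw [hx j hj]
    exact Finset.sum_eq_zero fun i hi => by rw [hS i hi, zero_mul]

theorem finrank_graphSpace {F : Type*} [Field F] {n : ℕ} (S : Finset (Fin n))
    (M : Fin n → Fin n → F) : finrank F (graphSpace S M) = S.card := by
  classical
  have hbij : Function.Bijective ((restrictTo F S).domRestrict (graphSpace S M)) := by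
    constructor
    · rw [injective_iff_map_eq_zero]
      rintro ⟨x, hx⟩ h0
      exact Subtype.ext (eq_zero_of_restrictTo_eq_zero hx h0)
    · intro y
      let y' : Fin n → F := fun i => if h : i ∈ S then y ⟨i, h⟩ else 0
      let x : Fin n → F := fun j => if j ∈ S then y' j else ∑ i ∈ S, y' i * M i j
      have hx : x ∈ graphSpace S M := by
        intro j hj
        simp only [x, if_neg hj]
        exact Finset.sum_congr rfl fun i hi => by rw [if_pos hi]
      refine ⟨⟨x, hx⟩, ?_⟩
      ext ⟨i, hi⟩
      change x i = _
      simp [x, y', hi]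
  rw [(LinearEquiv.ofBijective _ hbij).finrank_eq]
  simp

/-- The leading position of a nonzero element of a space in echelon form is a pivot. -/
theorem mem_of_leading {F : Type*} [Field F] {n : ℕ} {S : Finset (Fin n)}
    {M : Fin n → Fin n → F} (hM : ∀ i j, (i, j) ∉ ferrers S → M i j = 0) {x : Fin n → F}
    (hx : x ∈ graphSpace S M) {j : Fin n} (hj : x j ≠ 0) (hlt : ∀ i < j, x i = 0) : j ∈ S := by
  by_contra h
  refine hj ((hx j h).trans (Finset.sum_eq_zero fun i _ => ?_))
  -- Entries of x before j vanish, and entries of M at or left of the pivot vanish.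
  by_cases hij : i < j
  · rw [hlt i hij, zero_mul]
  · rw [hM i j (by simp [ferrers, hij]), mul_zero]

/-- A nonzero common vector has its leading position in both pivot sets, so restriction to S ∩ T is
injective on the intersection. -/
theorem finrank_inf_le_card_inter {F : Type*} [Field F] {n : ℕ} {S T : Finset (Fin n)}
    {M N : Fin n → Fin n → F} (hM : ∀ i j, (i, j) ∉ ferrers S → M i j = 0)
    (hN : ∀ i j, (i, j) ∉ ferrers T → N i j = 0) :
    finrank F (graphSpace S M ⊓ graphSpace T N : Submodule F (Fin n → F)) ≤ (S ∩ T).card := by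
  classical
  have hinj : Function.Injective ((restrictTo F (S ∩ T)).domRestrict
      (graphSpace S M ⊓ graphSpace T N)) := by
    rw [injective_iff_map_eq_zero]
    rintro ⟨x, hx⟩ h0
    by_contra hne
    have hne' : (Finset.univ.filter fun i => x i ≠ 0).Nonempty := by
      obtain ⟨i, hi⟩ := Function.ne_iff.1 (fun h : x = 0 => hne (Subtype.ext h))
      exact ⟨i, by simpa using hi⟩
    set j := (Finset.univ.filter fun i => x i ≠ 0).min' hne' with hjdef
    have hj : x j ≠ 0 := (Finset.mem_filter.1 (Finset.min'_mem _ hne')).2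
    have hlt : ∀ i < j, x i = 0 := fun i hi => by
      by_contra h
      exact absurd (Finset.min'_le _ i (by simpa using h)) (not_le.2 hi)
    exact hj (congrFun h0 ⟨j, Finset.mem_inter.2
      ⟨mem_of_leading hM hx.1 hj hlt, mem_of_leading hN hx.2 hj hlt⟩⟩)
  have h := LinearMap.finrank_le_finrank_of_injective hinj
  rwa [finrank_fintype_fun_eq_card, Fintype.card_coe] at h

/-- If two spaces with the same pivots meet in at least a hyperplane, the difference of their
matrices has rank at most one. -/
theorem exists_rank_one_of_finrank_inf {F : Type*} [Field F] {n : ℕ} {S : Finset (Fin n)}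
    {M N : Fin n → Fin n → F} (hM : ∀ i j, (i, j) ∉ ferrers S → M i j = 0)
    (hN : ∀ i j, (i, j) ∉ ferrers S → N i j = 0)
    (h : S.card ≤
      finrank F (graphSpace S M ⊓ graphSpace S N : Submodule F (Fin n → F)) + 1) :
    ∃ u v : Fin n → F, ∀ i j, (M - N) i j = u i * v j := by
  classical
  -- Row vectors times M - N. Pivot coordinates of common vectors lie in the kernel, so g has rank
  -- at most one.
  let g : (S → F) →ₗ[F] (Fin n → F) :=
    Fintype.linearCombination F (fun i : S => (M - N) i)
  have hg : ∀ y j, g y j = ∑ i : S, y i * (M i j - N i j) := fun y j => by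
    simp [g, Fintype.linearCombination_apply, Finset.sum_apply]
  have hker : ∀ x ∈ graphSpace S M ⊓ graphSpace S N, restrictTo F S x ∈ LinearMap.ker g := by
    intro x hx
    ext j
    rw [hg]
    change ∑ i : S, x i * (M i j - N i j) = 0
    by_cases hj : j ∈ S
    · refine Finset.sum_eq_zero fun i _ => ?_
      rw [hM i j (by simp [ferrers, hj]), hN i j (by simp [ferrers, hj]), sub_zero, mul_zero]
    · rw [Finset.sum_coe_sort S fun i => x i * (M i j - N i j)]
      simp only [mul_sub, Finset.sum_sub_distrib]
      rw [← hx.1 j hj, ← hx.2 j hj, sub_self]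
  have hle : finrank F (graphSpace S M ⊓ graphSpace S N : Submodule F (Fin n → F)) ≤
      finrank F (LinearMap.ker g) := by
    refine LinearMap.finrank_le_finrank_of_injective
      (f := (restrictTo F S).restrict hker) ?_
    rw [injective_iff_map_eq_zero]
    rintro ⟨x, hx⟩ h0
    exact Subtype.ext (eq_zero_of_restrictTo_eq_zero hx.1 (congrArg Subtype.val h0))
  have hrk := g.finrank_range_add_finrank_ker
  rw [finrank_fintype_fun_eq_card, Fintype.card_coe] at hrk
  obtain ⟨⟨v, hv⟩, hspan⟩ := finrank_le_one_iff.1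
    (show finrank F (LinearMap.range g) ≤ 1 by omega)
  have hrow : ∀ i ∈ S, ∃ c : F, ∀ j, (M - N) i j = c * v j := by
    intro i hi
    obtain ⟨c, hc⟩ := hspan ⟨g (Pi.single ⟨i, hi⟩ 1), LinearMap.mem_range_self g _⟩
    refine ⟨c, fun j => ?_⟩
    have := congrFun (congrArg Subtype.val hc) j
    simpa [g, Fintype.linearCombination_apply_single] using this.symm
  choose! u hu using hrow
  refine ⟨fun i => if i ∈ S then u i else 0, v, fun i j => ?_⟩
  by_cases hi : i ∈ S
  · simp only [if_pos hi, hu i hi j]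
  · simp [hi, hM i j (by simp [ferrers, hi]), hN i j (by simp [ferrers, hi])]

/-! ### The multilevel construction -/

/-- The dimension of the code of echelon forms with pivots `S` and rank distance two. -/
def dimBound {n : ℕ} (S : Finset (Fin n)) : ℕ :=
  (ferrers S).card - max ((ferrers S).image Prod.fst).card ((ferrers S).image Prod.snd).card

/-- The multilevel construction for subspace distance four. -/
theorem sum_pow_dimBound_le_maxCDC (F : Type*) [Field F] [Finite F] {n k : ℕ}
    (L : Finset (Finset (Fin n))) (hk : ∀ S ∈ L, S.card = k)
    (hL : ∀ S ∈ L, ∀ T ∈ L, S ≠ T → (S ∩ T).card + 2 ≤ k) :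
    ∑ S ∈ L, Nat.card F ^ dimBound S ≤ maxCDC F n 4 k := by
  classical
  choose C hsupp hrank hdim using fun S : Finset (Fin n) =>
    exists_rank_two_code F (ferrers S)
  have hcode : ∀ S ∈ L, ∀ T ∈ L, ∀ M ∈ C S, ∀ N ∈ C T, (S = T → M ≠ N) →
      finrank F (graphSpace S M ⊓ graphSpace T N : Submodule F (Fin n → F)) + 2 ≤ k := by
    intro S hS T hT M hM N hN hne
    by_cases hST : S = T
    · subst hST
      by_contra hlt
      obtain ⟨u, v, huv⟩ := exists_rank_one_of_finrank_inf (hsupp S M hM) (hsupp S N hN)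
        (by rw [hk S hS]; omega)
      exact hne rfl (sub_eq_zero.1 (hrank S (M - N) ((C S).sub_mem hM hN) u v huv))
    · exact (Nat.add_le_add_right
        (finrank_inf_le_card_inter (hsupp S M hM) (hsupp T N hN)) 2).trans (hL S hS T hT hST)
  let ι := Σ S : L, C S
  let U : ι → Submodule F (Fin n → F) := fun p => graphSpace p.1 p.2
  have hUk : ∀ p, finrank F (U p) = k := fun p =>
    (finrank_graphSpace _ _).trans (hk _ p.1.2)
  have hinf : ∀ p p' : ι, p ≠ p' →
      finrank F (U p ⊓ U p' : Submodule F (Fin n → F)) + 2 ≤ k := by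
    rintro ⟨⟨S, hS⟩, ⟨M, hM⟩⟩ ⟨⟨T, hT⟩, ⟨N, hN⟩⟩ hne
    refine hcode S hS T hT M hM N hN ?_
    rintro rfl rfl
    exact hne rfl
  have hinj : Function.Injective U := by
    intro p p' h
    by_contra hne
    have := hinf p p' hne
    rw [← h, inf_idem, hUk] at this
    omega
  have : Finite ι := inferInstance
  have := Fintype.ofFinite ι
  let W : Finset (Submodule F (Fin n → F)) := Finset.univ.map ⟨U, hinj⟩
  have hW : IsCDC F n W.card 4 k W := by
    refine ⟨?_, rfl, ?_⟩
    · intro V hV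
      obtain ⟨p, -, rfl⟩ := Finset.mem_map.1 hV
      exact hUk p
    · intro V hV V' hV' hne
      obtain ⟨p, -, rfl⟩ := Finset.mem_map.1 hV
      obtain ⟨p', -, rfl⟩ := Finset.mem_map.1 hV'
      have h1 := subspaceDist_add (U p) (U p')
      have h2 := hinf p p' (fun h => hne (by rw [h]))
      rw [hUk, hUk] at h1
      change 4 ≤ subspaceDist (U p) (U p')
      omega
  refine le_trans ?_ ((isGreatest_maxCDC F n 4 k).2 ⟨W, hW⟩)
  rw [Finset.card_map, Finset.card_univ, ← Nat.card_eq_fintype_card, Nat.card_sigma,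
    ← Finset.sum_coe_sort]
  refine Finset.sum_le_sum fun S _ => ?_
  rw [Module.natCard_eq_pow_finrank (K := F) (V := C S)]
  exact Nat.pow_le_pow_right (Nat.card_pos (α := F)) (hdim S)

end SubspaceCode

namespace SubspaceCode

/-- The multilevel construction for a skeleton given as a list of pivot sets. -/
theorem list_sum_pow_dimBound_le_maxCDC (F : Type*) [Field F] [Finite F] {n k : ℕ}
    (l : List (Finset (Fin n))) (hk : ∀ S ∈ l, S.card = k)
    (hl : l.Pairwise fun S T => (S ∩ T).card + 2 ≤ k) :
    (l.map fun S => Nat.card F ^ dimBound S).sum ≤ maxCDC F n 4 k := by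
  -- A repeated set would meet itself in k points, more than k - 2.
  have hnd : l.Nodup := by
    refine (List.pairwise_iff_forall_sublist.2 fun {S T} hST h => ?_)
    have h1 := List.pairwise_iff_forall_sublist.1 hl hST
    have h2 := hk S (hST.subset (by simp))
    rw [← h, Finset.inter_self] at h1
    omega
  rw [← List.sum_toFinset _ hnd]
  refine sum_pow_dimBound_le_maxCDC F l.toFinset (by simpa using hk) ?_
  intro S hS T hT hne
  have : Std.Symm fun S T : Finset (Fin n) => (S ∩ T).card + 2 ≤ k :=
    ⟨fun S T h => by rwa [Finset.inter_comm]⟩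
  exact hl.forall (List.mem_toFinset.1 hS) (List.mem_toFinset.1 hT) hne

/-! ### Explicit skeletons -/

/-- The subset of `Fin n` with characteristic vector the binary expansion of `m`, lowest bit
first. -/
def ofBits (n m : ℕ) : Finset (Fin n) :=
  Finset.univ.filter fun i => m.testBit i

/-- Pivot sets of the code over an arbitrary finite field. -/
def skeleton : List ℕ :=
  [31, 103, 122, 171, 182, 206, 211, 301, 307, 331, 341, 391, 412, 484, 558, 565, 589, 598, 665,
    737, 794, 866, 936, 976, 1084, 1113, 1165, 1178, 1201, 1236, 1256, 1294, 1362, 1377, 1442, 1543,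
    1577, 1586, 1610, 1636, 1812, 1921, 2105, 2140, 2197, 2220, 2249, 2274, 2326, 2346, 2416, 2465,
    2571, 2641, 2664, 2694, 2736, 2821, 3091, 3109, 3142, 3337, 3460, 3596, 3776, 3842, 4201, 4212,
    4261, 4280, 4377, 4390, 4428, 4490, 4545, 4627, 4636, 4770, 4808, 4912, 4996, 5131, 5142, 5189,
    5218, 5416, 5520, 5712, 6151, 6170, 6352, 6466, 6689, 6724, 6920, 7216, 7240, 7298]

/-- Pivot sets of the code over the field with two elements. -/
def binarySkeleton : List ℕ :=
  [31, 103, 124, 171, 182, 206, 211, 301, 307, 331, 341, 391, 409, 481, 558, 569, 589, 598, 661,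
    666, 740, 796, 866, 936, 976, 1077, 1082, 1113, 1165, 1236, 1256, 1294, 1362, 1380, 1442, 1543,
    1610, 1633, 1712, 1801, 1924, 2138, 2153, 2204, 2225, 2245, 2274, 2326, 2346, 2380, 2416, 2468,
    2571, 2597, 2610, 2641, 2694, 2760, 2945, 3091, 3110, 3210, 3333, 3352, 3520, 3596, 3842, 4202,
    4209, 4261, 4280, 4297, 4378, 4390, 4500, 4546, 4627, 4660, 4696, 4748, 4770, 4869, 5131, 5142,
    5164, 5189, 5265, 5424, 5448, 5824, 6151, 6169, 6228, 6290, 6433, 6536, 6696, 6722, 6928, 7264,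
    7300, 7681]

theorem card_skeleton : ∀ m ∈ skeleton, (ofBits 13 m).card = 5 := by
  decide +kernel

theorem card_binarySkeleton : ∀ m ∈ binarySkeleton, (ofBits 13 m).card = 5 := by
  decide +kernel

theorem pairwise_skeleton :
    (skeleton.map (ofBits 13)).Pairwise fun S T => (S ∩ T).card + 2 ≤ 5 := by
  decide +kernel

theorem pairwise_binarySkeleton :
    (binarySkeleton.map (ofBits 13)).Pairwise fun S T => (S ∩ T).card + 2 ≤ 5 := by
  decide +kernel

/-- These are the exponents of q in the bound. For instance 31 encodes the pivots 0, ..., 4 with a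
full 5 × 8 shape, giving 40 - 8 = 32. -/
theorem dimBound_skeleton : (skeleton.map (ofBits 13)).map dimBound =
  [32, 28, 24, 26, 24, 24, 24, 24, 24, 24, 22, 24, 20, 16, 23, 22, 22, 21, 19, 15, 18, 14, 13, 11,
    20, 19, 20, 18, 16, 15, 14, 19, 14, 13, 12, 20, 15, 14, 14, 12, 11, 8, 19, 18, 18, 16, 15, 13,
    17, 15, 11, 11, 18, 12, 11, 13, 9, 12, 16, 14, 13, 10, 6, 9, 2, 4, 16, 15, 16, 14, 15, 15, 13,
    12, 9, 16, 14, 9, 8, 8, 6, 16, 14, 12, 9, 7, 5, 5, 16, 12, 6, 5, 5, 4, 2, 4, 3, 2] := by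
  decide +kernel

theorem dimBound_binarySkeleton : (binarySkeleton.map (ofBits 13)).map dimBound =
  [32, 28, 24, 26, 24, 24, 24, 24, 24, 24, 22, 24, 20, 16, 23, 21, 22, 21, 20, 19, 15, 18, 14, 13,
    11, 21, 20, 19, 20, 15, 14, 19, 14, 13, 12, 20, 14, 12, 10, 12, 8, 18, 17, 17, 15, 16, 13, 17,
    15, 14, 11, 11, 18, 15, 13, 12, 13, 9, 7, 16, 14, 11, 11, 9, 3, 9, 4, 16, 15, 16, 14, 14, 15,
    15, 11, 9, 16, 12, 11, 11, 9, 11, 16, 14, 12, 12, 9, 7, 6, 2, 16, 12, 9, 8, 6, 4, 5, 4, 2, 3, 2,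
    0] := by
  decide +kernel

end SubspaceCode

theorem proposition1 :
    (∀ (F : Type*) [Field F] [Finite F], Nat.card F = 2 →
      4796825069 ≤ SubspaceCode.maxCDC F 13 4 5) ∧
    (∀ q : ℕ, IsPrimePow q → ∀ (F : Type*) [Field F] [Finite F], Nat.card F = q →
      q ^ 32 + q ^ 28 + q ^ 26 + 8 * q ^ 24 + q ^ 23 + 3 * q ^ 22 + q ^ 21 + 4 * q ^ 20
        + 4 * q ^ 19 + 5 * q ^ 18 + q ^ 17 + 9 * q ^ 16 + 8 * q ^ 15 + 9 * q ^ 14 + 6 * q ^ 13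
        + 7 * q ^ 12 + 5 * q ^ 11 + q ^ 10 + 5 * q ^ 9 + 3 * q ^ 8 + q ^ 7 + 3 * q ^ 6
        + 4 * q ^ 5 + 3 * q ^ 4 + q ^ 3 + 3 * q ^ 2 ≤ SubspaceCode.maxCDC F 13 4 5) := by
  refine ⟨fun F _ _ hF => ?_, fun q _ F _ _ hF => ?_⟩
  · have h := SubspaceCode.list_sum_pow_dimBound_le_maxCDC F _
      (List.forall_mem_map.2 SubspaceCode.card_binarySkeleton) SubspaceCode.pairwise_binarySkeleton
    rw [show (fun S : Finset (Fin 13) => Nat.card F ^ SubspaceCode.dimBound S) =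
      (fun e => Nat.card F ^ e) ∘ SubspaceCode.dimBound from rfl, ← List.map_map,
      SubspaceCode.dimBound_binarySkeleton, hF] at h
    -- The sum of these powers of 2 is exactly the stated number.
    exact le_of_eq_of_le (by decide +kernel) h
  · have h := SubspaceCode.list_sum_pow_dimBound_le_maxCDC F _
      (List.forall_mem_map.2 SubspaceCode.card_skeleton) SubspaceCode.pairwise_skeleton
    rw [show (fun S : Finset (Fin 13) => Nat.card F ^ SubspaceCode.dimBound S) =
      (fun e => Nat.card F ^ e) ∘ SubspaceCode.dimBound from rfl, ← List.map_map,
      SubspaceCode.dimBound_skeleton, hF] at h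
    refine le_of_eq_of_le ?_ h
    simp only [List.map_cons, List.map_nil, List.sum_cons, List.sum_nil]
    ring
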